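/- Let $G$ be a finite undirected graph (parallel edges and loops allowed) with a designated set $\partial V$ of boundary vertices such that every connected component of $G$ contains at least one boundary vertex, and let each edge $e$ have a weight $\mathrm{wt}(e)$ in a commutative ring $R$. A *grove* is a spanning forest of $G$ each of whose component trees contains at least one boundary vertex; its weight $\mathrm{wt}(g)$ is the product of the weights of its edges, and it induces the partition of $\partial V$ in which two boundary vertices lie in the same part exactly when they lie in the same tree. Let $\mathrm{Tree}(\partial V)$ be the set of groves inducing the partition of $\partial V$ into singletons. For tuples $\mathbf a=(a_1,\dots,a_k)$ and $\mathbf b=(b_1,\dots,b_k)$ of boundary vertices that are disjoint ($a_i\neq b_j$ for all $i,j$), let $\mathrm{Grove}_k(\mathbf a,\mathbf b)$ be the set of groves inducing the partition with parts $\{a_i,b_i\}$ for $1\le i\le k$ and singletons for all other boundary vertices, where $\mathrm{Grove}_k(\mathbf a,\mathbf b)=\varnothing$ if $\mathbf a$ or $\mathbf b$ has a repeated entry. Assume that $$Z_{\partial V}=\sum_{g\in\mathrm{Tree}(\partial V)}\mathrm{wt}(g)$$ is invertible in $R$, and put $$G_k(\mathbf a,\mathbf b)=\frac1{Z_{\partial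 V}}\sum_{g\in\mathrm{Grove}_k(\mathbf a,\mathbf b)}\mathrm{wt}(g),\qquad \tilde G_k(\mathbf a,\mathbf b)=\sum_{\sigma\in S_k}\mathrm{sgn}(\sigma)\,G_k(\mathbf a,\mathbf b_\sigma),\qquad \mathbf b_\sigma=(b_{\sigma(1)},\dots,b_{\sigma(k)}).$$ Then for every $k\ge 0$ and all disjoint $k$-tuples $\mathbf a,\mathbf b$ of boundary vertices, $$\tilde G_k(\mathbf a,\mathbf b)=\det\bigl(\tilde G_1(a_i,b_j)\bigr)_{i,j=1}^k.$$ -/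

import Mathlib

open scoped Graph

namespace Grove

/-!
`G : Graph α β` is Mathlib's undirected multigraph (parallel edges and loops allowed), with vertex
set `V(G)` and edge set `E(G)`.  A designated set `bd : Set V(G)` of boundary vertices makes it a
graph-with-boundary; the interior vertices are those in `bdᶜ`.  Edge weights are given by
`wt : β → R`, of which only the values on `E(G)` are used.
-/

/-- The simple graph on `V(G)` underlying the spanning subgraph of `G` with edge set `S`.  It has the
same connected components as that spanning subgraph. -/
def spanning {α β : Type*} (G : Graph α β) (S : Finset β) : SimpleGraph V(G) where
  Adj u v := u ≠ v ∧ ∃ e ∈ S, G.IsLink e u v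
  symm := ⟨fun _ _ h => ⟨h.1.symm, h.2.imp fun _ he => ⟨he.1, he.2.symm⟩⟩⟩

/-- Every connected component of `G` contains at least one boundary vertex. -/
def ComponentsMeetBoundary {α β : Type*} (G : Graph α β) (bd : Set V(G)) : Prop :=
  ∀ v : V(G), ∃ x ∈ bd, G.toSimpleGraph.Reachable v x

/-- The set `S` of edges of `G` is the edge set of a spanning forest: the spanning subgraph with
edge set `S` has no cycle, i.e. no loops, no parallel edges, and no cycle of length at least `3`. -/
structure IsSpanningForest {α β : Type*} (G : Graph α β) (S : Finset β) : Prop where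
  subset : (S : Set β) ⊆ E(G)
  simple : (G.restrict (S : Set β)).Simple
  acyclic : (spanning G S).IsAcyclic

/-- A grove (given by its edge set) is a spanning forest each of whose component trees contains at
least one boundary vertex. -/
structure IsGrove {α β : Type*} (G : Graph α β) (bd : Set V(G)) (S : Finset β) : Prop where
  isSpanningForest : IsSpanningForest G S
  meets_boundary : ∀ v : V(G), ∃ x ∈ bd, (spanning G S).Reachable v x

/-- The (set of parts of the) partition of the boundary induced by `S`: two boundary vertices are
in the same part when they are in the same component of the spanning subgraph. -/
def inducedPartition {α β : Type*} (G : Graph α β) (bd : Set V(G)) (S : Finset β) :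
    Set (Set V(G)) :=
  {P | ∃ x ∈ bd, P = {y | y ∈ bd ∧ (spanning G S).Reachable x y}}

/-- The (set of parts of the) partition of `bd` with parts `{a i, b i}`, and singletons for all other
elements of `bd`. -/
def pairingPartition {X : Type*} (bd : Set X) {k : ℕ} (a b : Fin k → X) : Set (Set X) :=
  {P | ∃ i, P = {a i, b i}} ∪ {P | ∃ x ∈ bd, x ∉ Set.range a ∧ x ∉ Set.range b ∧ P = {x}}

/-- `Tree(∂V)`: the groves that induce the partition of the boundary into singletons. -/
def treeSet {α β : Type*} (G : Graph α β) (bd : Set V(G)) : Set (Finset β) :=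
  {S | IsGrove G bd S ∧ inducedPartition G bd S = {P | ∃ x ∈ bd, P = {x}}}

/-- `Grove_k(a, b)`: the groves that induce the partition with parts `{a i, b i}` and singletons for
all other boundary vertices; by convention empty if `a` or `b` has a repeated entry. -/
def groveSet {α β : Type*} (G : Graph α β) (bd : Set V(G)) {k : ℕ} (a b : Fin k → V(G)) :
    Set (Finset β) :=
  {S | Function.Injective a ∧ Function.Injective b ∧
    IsGrove G bd S ∧ inducedPartition G bd S = pairingPartition bd a b}

/-- The weight of a set of edges is the product of the weights of its edges. -/
def weight {β R : Type*} [CommRing R] (wt : β → R) (S : Finset β) : R :=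
  ∏ e ∈ S, wt e

/-- `Z_{∂V}`: the sum of the weights of the groves in `Tree(∂V)`. -/
noncomputable def Z {α β R : Type*} [CommRing R] (G : Graph α β) (bd : Set V(G)) (wt : β → R) : R :=
  ∑ᶠ S ∈ treeSet G bd, weight wt S

/-- `G_k(a, b)`: the sum of the weights of the groves in `Grove_k(a, b)`, divided by `Z_{∂V}`
(which is meant to be a unit). -/
noncomputable def groveSum {α β R : Type*} [CommRing R] (G : Graph α β) (bd : Set V(G)) (wt : β → R)
    {k : ℕ} (a b : Fin k → V(G)) : R :=
  Ring.inverse (Z G bd wt) * ∑ᶠ S ∈ groveSet G bd a b, weight wt S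

/-- `G̃_k(a, b) = ∑ σ, sgn(σ) G_k(a, b_σ)`, where `b_σ = (b_{σ(1)}, …, b_{σ(k)})`. -/
noncomputable def signedGroveSum {α β R : Type*} [CommRing R] (G : Graph α β) (bd : Set V(G))
    (wt : β → R) {k : ℕ} (a b : Fin k → V(G)) : R :=
  ∑ σ : Equiv.Perm (Fin k), ((Equiv.Perm.sign σ : ℤ) : R) * groveSum G bd wt a (b ∘ σ)

end Grove

/-! Orient the edges arbitrarily and let `Δ = B W Bᵀ` be the weighted Laplacian, `B` being the
integer incidence matrix. Consider its minor with rows the interior vertices and the `a i`, and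
columns the interior vertices and the `b j`. Cauchy–Binet writes it as a sum over edge sets `S` of
`weight wt S` times two minors of `B`. Each of these is `±1` when `S` joins every vertex to a vertex
outside the chosen rows, and `0` otherwise. By an edge count both are nonzero exactly when `S` is a
grove pairing `a` with some `b ∘ σ`, and their product is then `(-1)^k sgn σ`
(`det_mul_det_eq_sum_perm`). So the minor is `(-1)^k` times the signed sum of grove weights
(`det_laplacian_rows`). For `k = 0` this says that the interior block has determinant `Z`. As `Z` is
a unit, the interior can be eliminated: the minor is `Z` times the determinant of the Schur
complement `L` at `(a i, b j)`. Hence the signed grove sum is `(-1)^k det L(a i, b j)`. Its case `k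
= 1` identifies the entries with `-L(a i, b j)`, which absorbs the sign. With a repeated entry in
`a` or `b` both sides vanish. -/

namespace Matrix

/-! ### Weighted Cauchy–Binet -/

/-- A Cauchy–Binet formula with weights: `d S` is the product of the minors with columns `S`, for
some enumeration of `S`. -/
theorem det_sum_mul_mul_eq_sum_powersetCard {m β R : Type*} [Fintype m] [DecidableEq m]
    [DecidableEq β] [CommRing R] (A B : Matrix m β R) (w : β → R) (E : Finset β)
    (d : Finset β → R)
    (hd : ∀ S ⊆ E, S.card = Fintype.card m → ∃ f : m → β, Function.Injective f ∧
      Finset.univ.image f = S ∧ d S = det (A.submatrix id f) * det (B.submatrix id f)) :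
    det (of fun i j => ∑ e ∈ E, A i e * w e * B j e) =
      ∑ S ∈ E.powersetCard (Fintype.card m), (∏ e ∈ S, w e) * d S := by
  -- Multilinearity in the rows: choose one edge `f i` for each row.
  have h1 : det (of fun i j => ∑ e ∈ E, A i e * w e * B j e) =
      ∑ f ∈ Fintype.piFinset (fun _ : m => E),
        (∏ i, A i (f i) * w (f i)) * det (B.submatrix id f) := by
    have : (of fun i j => ∑ e ∈ E, A i e * w e * B j e) =
        fun i => ∑ e ∈ E, (A i e * w e) • (fun j => B j e) := by
      ext i j; simp [Finset.sum_apply]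
    rw [this]
    change detRowAlternating.toMultilinearMap _ = _
    rw [MultilinearMap.map_sum_finset]
    refine Finset.sum_congr rfl fun f _ => ?_
    rw [MultilinearMap.map_smul_univ, smul_eq_mul]
    congr 1
    rw [← det_transpose]; rfl
  rw [h1]
  have h2 : ∀ f ∈ Fintype.piFinset (fun _ : m => E),
      (∏ i, A i (f i) * w (f i)) * det (B.submatrix id f) ≠ 0 → Function.Injective f := by
    intro f _ hne i j hij
    by_contra h
    refine hne ?_
    rw [det_zero_of_column_eq h (fun r => by simp [hij]), mul_zero]
  rw [← Finset.sum_filter_of_ne h2]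
  rw [← Finset.sum_fiberwise_of_maps_to (t := E.powersetCard (Fintype.card m))
    (g := fun f => Finset.univ.image f)]
  swap
  · intro f hf
    rw [Finset.mem_filter, Fintype.mem_piFinset] at hf
    rw [Finset.mem_powersetCard, Finset.card_image_of_injective _ hf.2]
    exact ⟨fun x hx => by
      obtain ⟨i, -, rfl⟩ := Finset.mem_image.1 hx; exact hf.1 i, rfl⟩
  refine Finset.sum_congr rfl fun S hS => ?_
  rw [Finset.mem_powersetCard] at hS
  obtain ⟨enum, hinj, himg, hdS⟩ := hd S hS.1 hS.2
  rw [hdS]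
  -- The injective `f` with image `S` are the maps `enum ∘ τ`; summing over `τ` rebuilds the Leibniz
  -- expansion of the `A`-minor.
  have h3 : ∑ τ : Equiv.Perm m, (∏ i, A i (enum (τ i)) * w (enum (τ i))) *
      det (B.submatrix id (enum ∘ τ)) =
      (∏ e ∈ S, w e) * (det (A.submatrix id enum) * det (B.submatrix id enum)) := by
    have hw : ∀ τ : Equiv.Perm m, ∏ i, w (enum (τ i)) = ∏ e ∈ S, w e := by
      intro τ
      rw [Equiv.prod_comp τ (fun i => w (enum i))]
      conv_rhs => rw [← himg]
      rw [Finset.prod_image hinj.injOn]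
    have hB : ∀ τ : Equiv.Perm m, det (B.submatrix id (enum ∘ τ)) =
        ((Equiv.Perm.sign τ : ℤ) : R) * det (B.submatrix id enum) := fun τ => by
      rw [← det_permute' τ]; rfl
    rw [det_apply' (A.submatrix id enum), Finset.sum_mul, Finset.mul_sum]
    -- `det_apply'` permutes the row index, whereas here the column index is permuted; inversion
    -- exchanges the two and keeps the sign.
    rw [← Equiv.sum_comp (Equiv.inv (Equiv.Perm m))]
    refine Finset.sum_congr rfl fun τ _ => ?_
    rw [hB, Finset.prod_mul_distrib, hw, ← Equiv.prod_comp τ]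
    simp
    ring
  rw [← h3]
  symm
  refine Finset.sum_bij (fun τ _ => enum ∘ τ) ?_ ?_ ?_ ?_
  · intro τ _
    have : Finset.univ.image (enum ∘ τ) = S := by
      rw [← Finset.image_image, Finset.image_univ_of_surjective τ.surjective, himg]
    simp only [Finset.mem_filter, Fintype.mem_piFinset]
    refine ⟨⟨fun i => hS.1 ?_, hinj.comp τ.injective⟩, this⟩
    exact this.subset (Finset.mem_image_of_mem (enum ∘ τ) (Finset.mem_univ i))
  · intro τ _ τ' _ h
    ext i
    exact hinj (congrFun h i)
  · intro f hf
    simp only [Finset.mem_filter, Fintype.mem_piFinset] at hf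
    obtain ⟨⟨_, hfi⟩, hfS⟩ := hf
    have : ∀ i, ∃ j, enum j = f i := fun i => by
      have : f i ∈ Finset.univ.image enum := by
        rw [himg, ← hfS]; exact Finset.mem_image_of_mem _ (Finset.mem_univ i)
      simpa using this
    choose g hg using this
    have hgi : Function.Injective g := fun i j h => hfi (by rw [← hg, ← hg, h])
    exact ⟨Equiv.ofBijective g (Finite.injective_iff_bijective.1 hgi), Finset.mem_univ _,
      funext hg⟩
  · intro τ _; rfl

end Matrix

namespace Grove

/-! ### Forests: edge counts and incidence matrices -/

section Counting

variable {α β : Type*} {G : Graph α β}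

theorem spanning_mono {S S' : Finset β} (h : S ⊆ S') : spanning G S ≤ spanning G S' :=
  fun _ _ hadj => ⟨hadj.1, hadj.2.imp fun _ he => ⟨h he.1, he.2⟩⟩

theorem reachable_of_isLink {S : Finset β} {e : β} (he : e ∈ S) {u v : V(G)}
    (h : G.IsLink e u v) : (spanning G S).Reachable u v := by
  by_cases huv : u = v
  · exact huv ▸ .rfl
  · exact SimpleGraph.Adj.reachable ⟨huv, e, he, h⟩

/-- Connectedness in a larger graph descends once every adjacency does. -/
theorem reachable_of_forall_adj {V : Type*} {H K : SimpleGraph V}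
    (h : ∀ u v, H.Adj u v → K.Reachable u v) {u v : V} (huv : H.Reachable u v) :
    K.Reachable u v := by
  obtain ⟨p⟩ := huv
  induction p with
  | nil => exact .rfl
  | cons hadj _ ih => exact (h _ _ hadj).trans ih

theorem exists_isLink {e : β} (he : e ∈ E(G)) : ∃ u v : V(G), G.IsLink e u v := by
  obtain ⟨x, y, h⟩ := Graph.exists_isLink_of_mem_edgeSet he
  exact ⟨⟨x, h.left_mem⟩, ⟨y, h.right_mem⟩, h⟩

/-- A set of edges is a spanning forest exactly when each of its edges is a bridge. -/
theorem isSpanningForest_iff [DecidableEq β] {S : Finset β} :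
    IsSpanningForest G S ↔ (S : Set β) ⊆ E(G) ∧ ∀ e ∈ S, ∀ u v : V(G), G.IsLink e u v →
      ¬ (spanning G (S.erase e)).Reachable u v := by
  constructor
  · rintro ⟨hsub, hsimple, hacyc⟩
    refine ⟨hsub, fun e he u v huv hr => ?_⟩
    have hne : u ≠ v := by
      rintro rfl
      exact hsimple.not_isLoopAt e u (Graph.restrict_isLoopAt.2 ⟨huv, he⟩)
    have hadj : (spanning G S).Adj u v := ⟨hne, e, he, huv⟩
    have hb := (SimpleGraph.isAcyclic_iff_forall_adj_isBridge.1 hacyc) hadj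
    rw [SimpleGraph.isBridge_iff] at hb
    refine hb (hr.mono ?_)
    rintro x y ⟨hxy, f, hf, hl⟩
    rw [Finset.mem_erase] at hf
    refine SimpleGraph.deleteEdges_adj.2 ⟨⟨hxy, f, hf.2, hl⟩, fun h => hf.1 ?_⟩
    have hl' : G.IsLink f u v := by
      rcases Sym2.eq_iff.1 h with ⟨rfl, rfl⟩ | ⟨rfl, rfl⟩
      · exact hl
      · exact hl.symm
    exact hsimple.eq_of_isLink (x := u) (y := v) (by simpa using ⟨hf.2, hl'⟩)
      (by simpa using ⟨he, huv⟩)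
  · rintro ⟨hsub, h⟩
    refine ⟨hsub, { not_isLoopAt := fun e x hx => ?_, eq_of_isLink := fun e f x y he hf => ?_ }, ?_⟩
    · rw [Graph.restrict_isLoopAt] at hx
      exact h e hx.2 ⟨x, hx.1.left_mem⟩ ⟨x, hx.1.left_mem⟩ hx.1 .rfl
    · simp only [Graph.restrict_isLink] at he hf
      by_contra hne
      have he1 : e ∈ S := by simpa using he.1
      have hf1 : f ∈ S := by simpa using hf.1
      exact h e he1 ⟨x, he.2.left_mem⟩ ⟨y, he.2.right_mem⟩ he.2
        (reachable_of_isLink (e := f) (Finset.mem_erase.2 ⟨Ne.symm hne, hf1⟩) hf.2)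
    · rw [SimpleGraph.isAcyclic_iff_forall_adj_isBridge]
      rintro u v ⟨hne, e, he, hl⟩
      rw [SimpleGraph.isBridge_iff]
      refine fun hr => h e he u v hl (hr.mono ?_)
      intro x y hxy
      rw [SimpleGraph.deleteEdges_adj] at hxy
      obtain ⟨⟨hxy', f, hf, hlf⟩, hnot⟩ := hxy
      refine ⟨hxy', f, Finset.mem_erase.2 ⟨?_, hf⟩, hlf⟩
      rintro rfl
      apply hnot
      rw [Set.mem_singleton_iff, Sym2.eq_iff]
      rcases hlf.eq_and_eq_or_eq_and_eq hl with ⟨h1, h2⟩ | ⟨h1, h2⟩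
      · exact .inl ⟨Subtype.ext h1, Subtype.ext h2⟩
      · exact .inr ⟨Subtype.ext h1, Subtype.ext h2⟩

theorem IsSpanningForest.mono {S S' : Finset β} (h : IsSpanningForest G S') (hS : S ⊆ S') :
    IsSpanningForest G S := by
  classical
  rw [isSpanningForest_iff] at h ⊢
  exact ⟨fun e he => h.1 (hS he), fun e he u v hl hr =>
    h.2 e (hS he) u v hl (hr.mono (spanning_mono (Finset.erase_subset_erase e hS)))⟩

/-- A forest in which the vertices of `T` lie in distinct trees has at most `|V| - |T|` edges. -/
theorem IsSpanningForest.card_add_card_le [Fintype V(G)] {S : Finset β}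
    (hS : IsSpanningForest G S) (T : Finset V(G))
    (hT : ∀ x ∈ T, ∀ y ∈ T, (spanning G S).Reachable x y → x = y) :
    S.card + T.card ≤ Fintype.card V(G) := by
  classical
  induction S using Finset.induction_on generalizing T with
  | empty => simpa using T.card_le_univ
  | insert e S he ih =>
    have hsub : S ⊆ insert e S := Finset.subset_insert e S
    have hF := isSpanningForest_iff.1 hS
    obtain ⟨u, v, huv⟩ := exists_isLink (hF.1 (by simp : e ∈ _))
    have hnr := hF.2 e (by simp) u v huv
    rw [Finset.erase_insert he] at hnr
    have hreach : (spanning G (insert e S)).Reachable u v := reachable_of_isLink (by simp) huv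
    -- Removing `e` splits a tree into the parts of `u` and `v`. A part that misses `T` contributes
    -- a further vertex to `T`, balancing the lost edge; both parts cannot meet `T`.
    have key : ∀ w : V(G), (∀ x ∈ T, ¬ (spanning G S).Reachable w x) →
        (insert e S).card + T.card ≤ Fintype.card V(G) := by
      intro w hw
      have hwT : w ∉ T := fun h => hw w h .rfl
      have := ih (hS.mono hsub) (insert w T) (by
        intro x hx y hy hxy
        rw [Finset.mem_insert] at hx hy
        rcases hx with rfl | hx <;> rcases hy with rfl | hy
        · rfl
        · exact (hw y hy hxy).elim
        · exact (hw x hx hxy.symm).elim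
        · exact hT x hx y hy (hxy.mono (spanning_mono hsub)))
      rw [Finset.card_insert_of_notMem hwT] at this
      rw [Finset.card_insert_of_notMem he]
      omega
    by_cases h : ∀ x ∈ T, ¬ (spanning G S).Reachable u x
    · exact key u h
    · push Not at h
      obtain ⟨x, hx, hux⟩ := h
      refine key v fun y hy hvy => hnr ?_
      have hxy := hT x hx y hy (((hux.mono (spanning_mono hsub)).symm.trans hreach).trans
        (hvy.mono (spanning_mono hsub)))
      exact hux.trans (hxy ▸ hvy.symm)

open Classical in
/-- The column of the (arbitrarily oriented) incidence matrix belonging to the edge `e`. -/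
noncomputable def incidence (G : Graph α β) (e : β) : V(G) → ℤ :=
  if h : ∃ p : V(G) × V(G), G.IsLink e p.1 p.2 then
    Pi.single h.choose.1 1 - Pi.single h.choose.2 1
  else 0

-- The orientation comes from a choice, so a column is known only up to sign; this suffices for
-- spans and zero sums.
open Classical in
theorem incidence_eq_or {e : β} {u v : V(G)} (h : G.IsLink e u v) :
    incidence G e = Pi.single u 1 - Pi.single v 1 ∨
      incidence G e = -(Pi.single u 1 - Pi.single v 1) := by
  have hex : ∃ p : V(G) × V(G), G.IsLink e p.1 p.2 := ⟨(u, v), h⟩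
  rw [incidence, dif_pos hex]
  rcases hex.choose_spec.eq_and_eq_or_eq_and_eq h with ⟨h1, h2⟩ | ⟨h1, h2⟩
  · left; rw [Subtype.ext h1, Subtype.ext h2]
  · right; rw [Subtype.ext h1, Subtype.ext h2, neg_sub]

/-- The matrix of incidences between the vertices `row i` and the edges `col j`. -/
noncomputable def incMatrix (G : Graph α β) {m n : Type*} (row : m → V(G)) (col : n → β) :
    Matrix m n ℤ :=
  Matrix.of fun i j => incidence G (col j) (row i)

/-- Edge columns telescope along a path from `row i` to a vertex outside the rows. The far end has
no coordinate, so the basis vector of `row i` remains. Working over `ℤ` is what later makes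
determinants units. -/
theorem incMatrix_mulVec_surjective {m n : Type*} [Fintype n] {S : Finset β}
    {row : m → V(G)} (hrow : Function.Injective row) [Finite m]
    {col : n → β} (hcol : ∀ e ∈ S, ∃ j, col j = e)
    (hS : ∀ v, ∃ x ∉ Set.range row, (spanning G S).Reachable v x) :
    Function.Surjective (incMatrix G row col).mulVecLin := by
  classical
  have := Fintype.ofFinite m
  -- The coordinate vector of `v`, which is zero when `v` is not a row.
  set φ : V(G) → m → ℤ := fun v i => if row i = v then 1 else 0 with hφ
  have hadj : ∀ u v, (spanning G S).Adj u v →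
      φ u - φ v ∈ LinearMap.range (incMatrix G row col).mulVecLin := by
    rintro u v ⟨_, e, he, hl⟩
    obtain ⟨j, rfl⟩ := hcol e he
    have hj : (incMatrix G row col).mulVecLin (Pi.single j 1) =
        fun i => incidence G (col j) (row i) := by
      ext i; simp [incMatrix]
    rcases incidence_eq_or hl with h | h
    · refine ⟨Pi.single j 1, ?_⟩
      rw [hj, h]; ext i; simp [hφ, Pi.single_apply]
    · refine ⟨-Pi.single j 1, ?_⟩
      rw [map_neg, hj, h]; ext i; simp [hφ, Pi.single_apply]
  have hreach : ∀ u v, (spanning G S).Reachable u v →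
      φ u - φ v ∈ LinearMap.range (incMatrix G row col).mulVecLin := by
    rintro u v ⟨p⟩
    induction p with
    | nil => simp
    | cons h _ ih => simpa using add_mem (hadj _ _ h) ih
  rw [← LinearMap.range_eq_top, eq_top_iff, ← (Pi.basisFun ℤ m).span_eq, Submodule.span_le]
  rintro _ ⟨i, rfl⟩
  obtain ⟨x, hx, hr⟩ := hS (row i)
  have := hreach _ _ hr
  have h0 : φ x = 0 := by
    ext j; simp only [hφ, Pi.zero_apply, ite_eq_right_iff]
    exact fun h => (hx ⟨j, h⟩).elim
  have h1 : φ (row i) = Pi.basisFun ℤ m i := by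
    ext j; simp [hφ, Pi.single_apply, hrow.eq_iff]
  rwa [h0, h1, sub_zero] at this

theorem det_incMatrix_mul_self {m : Type*} [Fintype m] [DecidableEq m] {row : m → V(G)}
    {S : Finset β} (hrow : Function.Injective row) {col : m → β} (hcol : ∀ e ∈ S, ∃ j, col j = e)
    (hS : ∀ v, ∃ x ∉ Set.range row, (spanning G S).Reachable v x) :
    (incMatrix G row col).det * (incMatrix G row col).det = 1 := by
  obtain ⟨B, hB⟩ := Matrix.mulVec_surjective_iff_exists_right_inverse.1
    (incMatrix_mulVec_surjective hrow hcol hS)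
  have h := congrArg Matrix.det hB
  rw [Matrix.det_mul, Matrix.det_one] at h
  have hu : IsUnit (incMatrix G row col).det := IsUnit.of_mul_eq_one _ h
  rw [← sq]
  exact Int.isUnit_sq hu

/-- With the vertices outside `T` as rows, the incidence matrix maps `ℤ^S` onto `ℤ^(V \ T)`; compare
ranks. -/
theorem card_le_card_add_card [Fintype V(G)] {S : Finset β} {T : Finset V(G)}
    (hS : ∀ v, ∃ x ∈ T, (spanning G S).Reachable v x) :
    Fintype.card V(G) ≤ S.card + T.card := by
  classical
  have := incMatrix_mulVec_surjective (G := G) (S := S) (m := {v // v ∉ T}) (n := S)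
    Subtype.val_injective (col := Subtype.val) (fun e he => ⟨⟨e, he⟩, rfl⟩) (by simpa using hS)
  have h := card_le_of_surjective ℤ _ this
  rw [Fintype.card_subtype_compl, Fintype.card_coe, Fintype.card_coe] at h
  omega

/-- An edge set with `|V| - |T|` edges which joins each vertex to `T` is a forest. -/
theorem isSpanningForest_of_card [Fintype V(G)] {S : Finset β} {T : Finset V(G)}
    (hE : (S : Set β) ⊆ E(G)) (hS : ∀ v, ∃ x ∈ T, (spanning G S).Reachable v x)
    (hcard : S.card + T.card = Fintype.card V(G)) : IsSpanningForest G S := by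
  classical
  rw [isSpanningForest_iff]
  refine ⟨hE, fun e he u v hl hr => ?_⟩
  -- If `e` is not a bridge, deleting it preserves connectedness, and `S.erase e` has too few edges.
  have hadj : ∀ x y, (spanning G S).Adj x y → (spanning G (S.erase e)).Reachable x y := by
    rintro x y ⟨hne, f, hf, hlf⟩
    by_cases hfe : f = e
    · subst hfe
      rcases hlf.eq_and_eq_or_eq_and_eq hl with ⟨h1, h2⟩ | ⟨h1, h2⟩
      · rwa [Subtype.ext h1, Subtype.ext h2]
      · rw [Subtype.ext h1, Subtype.ext h2]; exact hr.symm
    · exact reachable_of_isLink (Finset.mem_erase.2 ⟨hfe, hf⟩) hlf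
  have := card_le_card_add_card (S := S.erase e) (T := T) fun v => by
    obtain ⟨x, hx, h⟩ := hS v
    exact ⟨x, hx, reachable_of_forall_adj hadj h⟩
  have h2 := Finset.card_erase_lt_of_mem he
  omega

/-- Were two vertices of `T` connected, one could be dropped from `T`, violating the lower bound on
edges. -/
theorem eq_of_reachable_of_card [Fintype V(G)] {S : Finset β} {T : Finset V(G)}
    (hS : ∀ v, ∃ x ∈ T, (spanning G S).Reachable v x)
    (hcard : S.card + T.card = Fintype.card V(G)) {x y : V(G)} (hx : x ∈ T) (hy : y ∈ T)
    (hxy : (spanning G S).Reachable x y) : x = y := by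
  classical
  by_contra hne
  have := card_le_card_add_card (S := S) (T := T.erase y) fun v => by
    obtain ⟨z, hz, h⟩ := hS v
    by_cases hzy : z = y
    · exact ⟨x, Finset.mem_erase.2 ⟨hne, hx⟩, h.trans (hzy ▸ hxy.symm)⟩
    · exact ⟨z, Finset.mem_erase.2 ⟨hzy, hz⟩, h⟩
  have h2 := Finset.card_erase_lt_of_mem hy
  omega

end Counting

/-! ### Groves that pair `a` with `b` -/

section Pairing

variable {α β : Type*} {G : Graph α β} {bd : Set V(G)} {k : ℕ} {a b : Fin k → V(G)}
  {S : Finset β}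

/-- For valid tuples, membership in `groveSet` in terms of connectedness of boundary vertices. -/
theorem mem_groveSet_iff (hai : Function.Injective a) (hbi : Function.Injective b)
    (ha : ∀ i, a i ∈ bd) (hb : ∀ i, b i ∈ bd) (hab : ∀ i j, a i ≠ b j) :
    S ∈ groveSet G bd a b ↔ IsGrove G bd S ∧ ∀ x ∈ bd, ∀ y ∈ bd,
      ((spanning G S).Reachable x y ↔
        x = y ∨ ∃ i, (x = a i ∧ y = b i) ∨ (x = b i ∧ y = a i)) := by
  simp only [groveSet, Set.mem_ofPred_eq, hai, hbi, true_and]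
  refine and_congr_right fun _ => ⟨fun h x hx y hy => ?_, fun h => ?_⟩
  · have hx' : {y | y ∈ bd ∧ (spanning G S).Reachable x y} ∈ pairingPartition bd a b := by
      rw [← h]; exact ⟨x, hx, rfl⟩
    have hxx : x ∈ {y | y ∈ bd ∧ (spanning G S).Reachable x y} := ⟨hx, .rfl⟩
    have hy' : (spanning G S).Reachable x y ↔
        y ∈ {y | y ∈ bd ∧ (spanning G S).Reachable x y} := by simp [hy]
    rw [hy']
    rcases hx' with ⟨i, hi⟩ | ⟨z, _, hza, hzb, hz⟩
    · rw [hi] at hxx ⊢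
      simp only [Set.mem_insert_iff, Set.mem_singleton_iff] at hxx ⊢
      constructor
      · rintro (rfl | rfl) <;> rcases hxx with rfl | rfl
        · exact .inl rfl
        · exact .inr ⟨i, .inr ⟨rfl, rfl⟩⟩
        · exact .inr ⟨i, .inl ⟨rfl, rfl⟩⟩
        · exact .inl rfl
      · rintro (rfl | ⟨j, ⟨rfl, rfl⟩ | ⟨rfl, rfl⟩⟩)
        · exact hxx
        · rcases hxx with h | h
          · exact .inr (by rw [hai h])
          · exact (hab _ _ h).elim
        · rcases hxx with h | h
          · exact (hab _ _ h.symm).elim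
          · exact .inl (by rw [hbi h])
    · rw [hz] at hxx ⊢
      simp only [Set.mem_singleton_iff] at hxx ⊢
      subst hxx
      constructor
      · exact fun h => .inl h.symm
      · rintro (rfl | ⟨j, ⟨rfl, rfl⟩ | ⟨rfl, rfl⟩⟩)
        · rfl
        · exact (hza ⟨j, rfl⟩).elim
        · exact (hzb ⟨j, rfl⟩).elim
  · have hA : ∀ i, {y | y ∈ bd ∧ (spanning G S).Reachable (a i) y} = {a i, b i} := by
      intro i; ext y
      simp only [Set.mem_ofPred_eq, Set.mem_insert_iff, Set.mem_singleton_iff]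
      constructor
      · rintro ⟨hy, hr⟩
        rcases (h _ (ha i) _ hy).1 hr with rfl | ⟨j, ⟨h1, rfl⟩ | ⟨h1, _⟩⟩
        · exact .inl rfl
        · exact .inr (by rw [hai h1])
        · exact (hab _ _ h1).elim
      · rintro (rfl | rfl)
        · exact ⟨ha i, .rfl⟩
        · exact ⟨hb i, (h _ (ha i) _ (hb i)).2 (.inr ⟨i, .inl ⟨rfl, rfl⟩⟩)⟩
    have hB : ∀ i, {y | y ∈ bd ∧ (spanning G S).Reachable (b i) y} = {a i, b i} := by
      intro i
      have hr := (h _ (ha i) _ (hb i)).2 (.inr ⟨i, .inl ⟨rfl, rfl⟩⟩)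
      rw [← hA]; ext y
      exact and_congr_right fun _ => ⟨hr.trans, hr.symm.trans⟩
    have hC : ∀ x ∈ bd, x ∉ Set.range a → x ∉ Set.range b →
        {y | y ∈ bd ∧ (spanning G S).Reachable x y} = {x} := by
      intro x hx hxa hxb; ext y
      simp only [Set.mem_ofPred_eq, Set.mem_singleton_iff]
      constructor
      · rintro ⟨hy, hr⟩
        rcases (h _ hx _ hy).1 hr with rfl | ⟨j, ⟨rfl, _⟩ | ⟨rfl, _⟩⟩
        · rfl
        · exact (hxa ⟨j, rfl⟩).elim
        · exact (hxb ⟨j, rfl⟩).elim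
      · rintro rfl
        exact ⟨hx, .rfl⟩
    ext P
    constructor
    · rintro ⟨x, hx, rfl⟩
      by_cases hxa : x ∈ Set.range a
      · obtain ⟨i, rfl⟩ := hxa
        exact .inl ⟨i, hA i⟩
      by_cases hxb : x ∈ Set.range b
      · obtain ⟨i, rfl⟩ := hxb
        exact .inl ⟨i, hB i⟩
      exact .inr ⟨x, hx, hxa, hxb, hC x hx hxa hxb⟩
    · rintro (⟨i, rfl⟩ | ⟨x, hx, hxa, hxb, rfl⟩)
      · exact ⟨a i, ha i, (hA i).symm⟩
      · exact ⟨x, hx, (hC x hx hxa hxb).symm⟩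

/-- The interior vertices, followed by the vertices `a i`. -/
def rows (bd : Set V(G)) (a : Fin k → V(G)) : {v // v ∉ bd} ⊕ Fin k → V(G) :=
  Sum.elim Subtype.val a

theorem rows_injective (hai : Function.Injective a) (ha : ∀ i, a i ∈ bd) :
    Function.Injective (rows bd a) :=
  Subtype.val_injective.sumElim hai fun x i h => x.2 (h ▸ ha i)

theorem notMem_range_rows {x : V(G)} :
    x ∉ Set.range (rows bd a) ↔ x ∈ bd ∧ x ∉ Set.range a := by
  simp [rows, Set.Sum.elim_range]

/-- A tree meets the boundary outside `a`, or contains some `a i` and with it `b i`. Together with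
`eq_of_reachable_of_mem_groveSet`, the boundary vertices outside `a` form a transversal of the
trees. -/
theorem exists_reachable_of_mem_groveSet (hai : Function.Injective a) (hbi : Function.Injective b)
    (ha : ∀ i, a i ∈ bd) (hb : ∀ i, b i ∈ bd) (hab : ∀ i j, a i ≠ b j)
    (hS : S ∈ groveSet G bd a b) (v : V(G)) :
    ∃ x ∉ Set.range (rows bd a), (spanning G S).Reachable v x := by
  rw [mem_groveSet_iff hai hbi ha hb hab] at hS
  obtain ⟨x, hx, hvx⟩ := hS.1.meets_boundary v
  by_cases hxa : x ∈ Set.range a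
  · obtain ⟨i, rfl⟩ := hxa
    refine ⟨b i, notMem_range_rows.2 ⟨hb i, ?_⟩, hvx.trans
      ((hS.2 _ (ha i) _ (hb i)).2 (.inr ⟨i, .inl ⟨rfl, rfl⟩⟩))⟩
    rintro ⟨j, hj⟩
    exact hab _ _ hj
  · exact ⟨x, notMem_range_rows.2 ⟨hx, hxa⟩, hvx⟩

theorem eq_of_reachable_of_mem_groveSet (hai : Function.Injective a)
    (hbi : Function.Injective b)
    (ha : ∀ i, a i ∈ bd) (hb : ∀ i, b i ∈ bd) (hab : ∀ i j, a i ≠ b j)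
    (hS : S ∈ groveSet G bd a b) {x y : V(G)} (hx : x ∉ Set.range (rows bd a))
    (hy : y ∉ Set.range (rows bd a)) (hxy : (spanning G S).Reachable x y) : x = y := by
  rw [mem_groveSet_iff hai hbi ha hb hab] at hS
  rw [notMem_range_rows] at hx hy
  rcases (hS.2 x hx.1 y hy.1).1 hxy with h | ⟨i, ⟨rfl, _⟩ | ⟨_, rfl⟩⟩
  · exact h
  · exact (hx.2 ⟨i, rfl⟩).elim
  · exact (hy.2 ⟨i, rfl⟩).elim

/-- Joining each vertex both to `bd \ range a` and to `bd \ range b` with the least number of edges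
pairs up `a` with `b`. -/
theorem exists_perm_mem_groveSet [Fintype V(G)] (hai : Function.Injective a)
    (hbi : Function.Injective b)
    (ha : ∀ i, a i ∈ bd) (hb : ∀ i, b i ∈ bd) (hab : ∀ i j, a i ≠ b j)
    (hE : (S : Set β) ⊆ E(G)) {Ta Tb : Finset V(G)}
    (hTa : ∀ x, x ∈ Ta ↔ x ∉ Set.range (rows bd a))
    (hTb : ∀ x, x ∈ Tb ↔ x ∉ Set.range (rows bd b))
    (hSa : ∀ v, ∃ x ∈ Ta, (spanning G S).Reachable v x)
    (hSb : ∀ v, ∃ x ∈ Tb, (spanning G S).Reachable v x)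
    (hca : S.card + Ta.card = Fintype.card V(G)) (hcb : S.card + Tb.card = Fintype.card V(G)) :
    ∃ σ : Equiv.Perm (Fin k), S ∈ groveSet G bd a (b ∘ σ) := by
  simp only [notMem_range_rows] at hTa hTb
  have ha_unique : ∀ {x y}, x ∈ Ta → y ∈ Ta → (spanning G S).Reachable x y → x = y :=
    fun hx hy h => eq_of_reachable_of_card hSa hca hx hy h
  have hb_unique : ∀ {x y}, x ∈ Tb → y ∈ Tb → (spanning G S).Reachable x y → x = y :=
    fun hx hy h => eq_of_reachable_of_card hSb hcb hx hy h
  have haTb : ∀ i, a i ∈ Tb := fun i =>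
    (hTb _).2 ⟨ha i, by rintro ⟨j, hj⟩; exact hab _ _ hj.symm⟩
  have hbTa : ∀ i, b i ∈ Ta := fun i =>
    (hTa _).2 ⟨hb i, by rintro ⟨j, hj⟩; exact hab _ _ hj⟩
  -- `a i` reaches a boundary vertex outside `a`. If that vertex were not in `b`, it and `a i` would
  -- be two connected members of `Tb`.
  have hex : ∀ i, ∃ j, (spanning G S).Reachable (a i) (b j) := by
    intro i
    obtain ⟨x, hx, hr⟩ := hSa (a i)
    by_cases hxb : x ∈ Set.range b
    · obtain ⟨j, rfl⟩ := hxb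
      exact ⟨j, hr⟩
    · have := hb_unique (haTb i) ((hTb x).2 ⟨((hTa x).1 hx).1, hxb⟩) hr
      exact (((hTa x).1 hx).2 ⟨i, this⟩).elim
  choose f hf using hex
  have hfi : Function.Injective f := fun i j hij =>
    hai (hb_unique (haTb i) (haTb j) ((hf i).trans (hij ▸ (hf j).symm)))
  refine ⟨Equiv.ofBijective f (Finite.injective_iff_bijective.1 hfi), ?_⟩
  rw [mem_groveSet_iff hai (hbi.comp (Equiv.injective _)) ha (fun i => hb _)
    (fun i j => hab _ _)]
  refine ⟨⟨isSpanningForest_of_card hE hSa hca, fun v => ?_⟩, fun x hx y hy => ⟨fun h => ?_, ?_⟩⟩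
  · obtain ⟨x, hx, h⟩ := hSa v
    exact ⟨x, ((hTa x).1 hx).1, h⟩
  · by_cases hxa : x ∈ Set.range a
    · obtain ⟨i, rfl⟩ := hxa
      by_cases hya : y ∈ Set.range a
      · obtain ⟨j, rfl⟩ := hya
        exact .inl (hb_unique (haTb i) (haTb j) h)
      · refine .inr ⟨i, .inl ⟨rfl, ?_⟩⟩
        exact ha_unique ((hTa y).2 ⟨hy, hya⟩) (hbTa _) (h.symm.trans (hf i))
    · by_cases hya : y ∈ Set.range a
      · obtain ⟨j, rfl⟩ := hya
        refine .inr ⟨j, .inr ⟨?_, rfl⟩⟩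
        exact ha_unique ((hTa x).2 ⟨hx, hxa⟩) (hbTa _) (h.trans (hf j))
      · exact .inl (ha_unique ((hTa x).2 ⟨hx, hxa⟩) ((hTa y).2 ⟨hy, hya⟩) h)
  · rintro (rfl | ⟨i, ⟨rfl, rfl⟩ | ⟨rfl, rfl⟩⟩)
    · exact .rfl
    · exact hf i
    · exact (hf i).symm

theorem perm_eq_of_mem_groveSet (hai : Function.Injective a) (hbi : Function.Injective b)
    (ha : ∀ i, a i ∈ bd) (hb : ∀ i, b i ∈ bd) (hab : ∀ i j, a i ≠ b j)
    {σ τ : Equiv.Perm (Fin k)} (hσ : S ∈ groveSet G bd a (b ∘ σ))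
    (hτ : S ∈ groveSet G bd a (b ∘ τ)) : σ = τ := by
  rw [mem_groveSet_iff hai (hbi.comp σ.injective) ha (fun i => hb _) (fun i j => hab _ _)] at hσ
  rw [mem_groveSet_iff hai (hbi.comp τ.injective) ha (fun i => hb _) (fun i j => hab _ _)] at hτ
  ext1 i
  have h := (hσ.2 _ (ha i) _ (hb (σ i))).2 (.inr ⟨i, .inl ⟨rfl, rfl⟩⟩)
  rcases (hτ.2 _ (ha i) _ (hb (σ i))).1 h with h | ⟨j, ⟨h1, h2⟩ | ⟨h1, _⟩⟩
  · exact (hab _ _ h).elim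
  · obtain rfl := hai h1
    exact hbi h2
  · exact (hab _ _ h1).elim

end Pairing

/-! ### Products of incidence minors -/

section Minors

open Classical

variable {α β : Type*} {G : Graph α β} {bd : Set V(G)} {k : ℕ} {a b : Fin k → V(G)}
  {S : Finset β} [Fintype V(G)]

/-- Both ends of an edge of `S` lie in the component of `w` or neither does, so the entries `1` and
`-1` cancel. -/
theorem sum_incidence_component (w : V(G)) {e : β} (he : e ∈ S) :
    ∑ v, (if (spanning G S).Reachable w v then incidence G e v else 0) = 0 := by
  by_cases h : e ∈ E(G)
  · obtain ⟨x, y, hl⟩ := exists_isLink h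
    have hxy : (spanning G S).Reachable w x ↔ (spanning G S).Reachable w y :=
      ⟨fun h => h.trans (reachable_of_isLink he hl),
        fun h => h.trans (reachable_of_isLink he hl).symm⟩
    have key : ∑ v, (if (spanning G S).Reachable w v then
        (Pi.single x 1 - Pi.single y 1 : V(G) → ℤ) v else 0) = 0 := by
      by_cases hw : (spanning G S).Reachable w x
      · have hw' := hxy.1 hw
        have : ∀ v, (if (spanning G S).Reachable w v then
          (Pi.single x 1 - Pi.single y 1 : V(G) → ℤ) v else 0) =
          (Pi.single x 1 : V(G) → ℤ) v - (Pi.single y 1 : V(G) → ℤ) v := by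
          intro v
          split_ifs with hv
          · rfl
          · rw [Pi.single_eq_of_ne (by rintro rfl; exact hv hw),
              Pi.single_eq_of_ne (by rintro rfl; exact hv hw'), sub_zero]
        rw [Finset.sum_congr rfl fun v _ => this v, Finset.sum_sub_distrib]
        simp
      · have hw' := fun h => hw (hxy.2 h)
        refine Finset.sum_eq_zero fun v _ => ?_
        split_ifs with hv
        · rw [Pi.sub_apply, Pi.single_eq_of_ne (by rintro rfl; exact hw hv),
            Pi.single_eq_of_ne (by rintro rfl; exact hw' hv), sub_zero]
        · rfl
    rcases incidence_eq_or hl with h | h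
    · rw [h]; exact key
    · rw [h, ← neg_eq_zero, ← Finset.sum_neg_distrib]
      refine Eq.trans ?_ key
      refine Finset.sum_congr rfl fun v _ => ?_
      split_ifs <;> simp
  · have : incidence G e = 0 := by
      rw [incidence, dif_neg]
      rintro ⟨p, hp⟩
      exact h hp.edge_mem
    simp [this]

/-- A component contained in the rows has an indicator vector that is a nonzero left kernel vector.
-/
theorem det_incMatrix_eq_zero {m : Type*} [Fintype m] [DecidableEq m] {row : m → V(G)}
    (hrow : Function.Injective row) {col : m → β} (hcol : ∀ j, col j ∈ S)
    (hS : ¬ ∀ v, ∃ x ∉ Set.range row, (spanning G S).Reachable v x) :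
    (incMatrix G row col).det = 0 := by
  push Not at hS
  obtain ⟨w, hw⟩ := hS
  rw [← Matrix.exists_vecMul_eq_zero_iff]
  refine ⟨fun i => if (spanning G S).Reachable w (row i) then 1 else 0, fun h => ?_, ?_⟩
  · have hwr : w ∈ Set.range row := by
      by_contra h
      exact hw w h .rfl
    obtain ⟨i, rfl⟩ := hwr
    simpa using congrFun h i
  · ext j
    refine Eq.trans ?_ (sum_incidence_component w (hcol j))
    refine Fintype.sum_of_injective row hrow _ _ (fun v hv => ?_) fun i => ?_
    · rw [if_neg (hw v hv)]
    · simp [incMatrix]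

/-- In a grove pairing `a` with `b`, the rows `b i` equal the rows `-a i` up to interior rows. -/
theorem det_incMatrix_rows_of_mem_groveSet (hai : Function.Injective a)
    (hbi : Function.Injective b)
    (ha : ∀ i, a i ∈ bd) (hb : ∀ i, b i ∈ bd) (hab : ∀ i j, a i ≠ b j)
    (hS : S ∈ groveSet G bd a b) {col : {v // v ∉ bd} ⊕ Fin k → β} (hcol : ∀ j, col j ∈ S) :
    (incMatrix G (rows bd b) col).det = (-1) ^ k * (incMatrix G (rows bd a) col).det := by
  rw [mem_groveSet_iff hai hbi ha hb hab] at hS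
  -- The column sum over the tree of `a i` is zero, and its only boundary vertices are `a i` and `b
  -- i`. So row `b i` is minus row `a i` minus the tree's interior rows: a block triangular change
  -- of rows of determinant `(-1)^k`.
  set C : Matrix (Fin k) {v // v ∉ bd} ℤ :=
    Matrix.of fun i v => if (spanning G S).Reachable (a i) v then -1 else 0 with hC
  have h : incMatrix G (rows bd b) col =
      Matrix.fromBlocks 1 0 C (-1) * incMatrix G (rows bd a) col := by
    ext i j
    rcases i with v | i
    · simp [Matrix.mul_apply, incMatrix, rows, Fintype.sum_sum_type, Matrix.one_apply]
    · have h0 := sum_incidence_component (G := G) (a i) (hcol j)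
      have h1 : ∑ s : {v // v ∉ bd} ⊕ Fin 2,
          (if (spanning G S).Reachable (a i) ((Sum.elim Subtype.val ![a i, b i] :
            {v // v ∉ bd} ⊕ Fin 2 → V(G)) s) then incidence G (col j)
            ((Sum.elim Subtype.val ![a i, b i] : {v // v ∉ bd} ⊕ Fin 2 → V(G)) s) else 0) = 0 := by
        refine Eq.trans ?_ h0
        refine Fintype.sum_of_injective (Sum.elim Subtype.val ![a i, b i]) ?_ _ _ ?_ fun s => rfl
        · refine Subtype.val_injective.sumElim ?_ ?_
          · intro p q hpq
            fin_cases p <;> fin_cases q <;> simp_all [(hab i i).symm]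
          · intro x q hq
            apply x.2
            rw [hq]
            fin_cases q
            · exact ha i
            · exact hb i
        · intro v hv
          rw [if_neg]
          intro hr
          have hvb : v ∈ bd := by
            by_contra hvb
            exact hv ⟨.inl ⟨v, hvb⟩, rfl⟩
          rcases (hS.2 _ (ha i) _ hvb).1 hr with rfl | ⟨l, ⟨h1, rfl⟩ | ⟨h1, _⟩⟩
          · exact hv ⟨.inr 0, rfl⟩
          · exact hv ⟨.inr 1, by rw [hai h1]; rfl⟩
          · exact hab _ _ h1
      have hr : (spanning G S).Reachable (a i) (b i) :=
        (hS.2 _ (ha i) _ (hb i)).2 (.inr ⟨i, .inl ⟨rfl, rfl⟩⟩)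
      have hneg : ∑ v : {v // v ∉ bd}, C i v * incidence G (col j) v =
          -∑ v : {v // v ∉ bd}, (if (spanning G S).Reachable (a i) v then
            incidence G (col j) v else 0) := by
        rw [← Finset.sum_neg_distrib]
        refine Finset.sum_congr rfl fun v _ => ?_
        simp only [hC, Matrix.of_apply]
        split_ifs <;> simp
      simp only [Fintype.sum_sum_type, Sum.elim_inl, Sum.elim_inr, Fin.sum_univ_two,
        Matrix.cons_val_zero, Matrix.cons_val_one, hr, if_true,
        SimpleGraph.Reachable.refl] at h1
      have h2 : (Matrix.fromBlocks 1 0 C (-1) * incMatrix G (rows bd a) col :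
          Matrix ({v // v ∉ bd} ⊕ Fin k) _ ℤ) (.inr i) j =
          ∑ v : {v // v ∉ bd}, C i v * incidence G (col j) v - incidence G (col j) (a i) := by
        simp [Matrix.mul_apply, incMatrix, rows, Fintype.sum_sum_type, Matrix.one_apply,
          sub_eq_add_neg]
      rw [h2, hneg]
      simp only [incMatrix, rows, Matrix.of_apply, Sum.elim_inr]
      have h4 : ∀ x y z : ℤ, x + (y + z) = 0 → z = -x - y := by intros; linarith
      convert h4 _ _ _ h1
      congr
  rw [h, Matrix.det_mul, Matrix.det_fromBlocks_zero₁₂, Matrix.det_one, one_mul, Matrix.det_neg,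
    Matrix.det_one, mul_one, Fintype.card_fin]

theorem det_incMatrix_rows_comp_perm (σ : Equiv.Perm (Fin k))
    (col : {v // v ∉ bd} ⊕ Fin k → β) :
    (incMatrix G (rows bd (b ∘ σ)) col).det =
      (Equiv.Perm.sign σ : ℤ) * (incMatrix G (rows bd b) col).det := by
  have h : incMatrix G (rows bd (b ∘ σ)) col =
      (incMatrix G (rows bd b) col).submatrix (Equiv.Perm.sumCongr 1 σ) id := by
    ext i j
    rcases i with v | i <;> simp [incMatrix, rows]
  rw [h, Matrix.det_permute, Equiv.Perm.sign_sumCongr]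
  simp

theorem card_add_card_notMem_range {m : Type*} [Fintype m] [DecidableEq m] {row : m → V(G)}
    (hrow : Function.Injective row) :
    Fintype.card m + (Finset.univ.filter fun x => x ∉ Set.range row).card =
      Fintype.card V(G) := by
  have h : (Finset.univ.filter fun x => x ∈ Set.range row).card = Fintype.card m := by
    rw [← Finset.card_univ, ← Finset.card_image_of_injective _ hrow]
    congr 1; ext x; simp
  rw [← h, Finset.card_filter_add_card_filter_not, Finset.card_univ]

/-- The vertices outside `rows bd a` form a transversal of the trees, so the lower bound from
surjectivity and the upper bound for forests coincide. -/
theorem card_of_mem_groveSet (hai : Function.Injective a) (hbi : Function.Injective b)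
    (ha : ∀ i, a i ∈ bd) (hb : ∀ i, b i ∈ bd) (hab : ∀ i j, a i ≠ b j)
    (hS : S ∈ groveSet G bd a b) : S.card = Fintype.card ({v // v ∉ bd} ⊕ Fin k) := by
  have h1 := card_add_card_notMem_range (rows_injective hai ha)
  have h2 := card_le_card_add_card (S := S)
    (T := Finset.univ.filter fun x => x ∉ Set.range (rows bd a))
    (by simpa only [Finset.mem_filter, Finset.mem_univ, true_and] using
      exists_reachable_of_mem_groveSet hai hbi ha hb hab hS)
  have h3 := hS.2.2.1.isSpanningForest.card_add_card_le
    (Finset.univ.filter fun x => x ∉ Set.range (rows bd a)) fun x hx y hy =>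
      eq_of_reachable_of_mem_groveSet hai hbi ha hb hab hS (Finset.mem_filter.1 hx).2
        (Finset.mem_filter.1 hy).2
  omega

/-- At most one `σ` contributes. For it, reordering `b` costs `sgn σ`, replacing the rows `b ∘ σ` by
`a` costs `(-1)^k`, and the square of a determinant `±1` remains. If no `σ` exists, two nonzero
minors would let `exists_perm_mem_groveSet` produce one. -/
theorem det_mul_det_eq_sum_perm (hai : Function.Injective a) (hbi : Function.Injective b)
    (ha : ∀ i, a i ∈ bd) (hb : ∀ i, b i ∈ bd) (hab : ∀ i j, a i ≠ b j)
    (hE : (S : Set β) ⊆ E(G)) {col : {v // v ∉ bd} ⊕ Fin k → β}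
    (hcard : S.card = Fintype.card ({v // v ∉ bd} ⊕ Fin k))
    (hcol : Finset.univ.image col = S) :
    (incMatrix G (rows bd a) col).det * (incMatrix G (rows bd b) col).det =
      ∑ σ : Equiv.Perm (Fin k),
        if S ∈ groveSet G bd a (b ∘ σ) then (-1) ^ k * (Equiv.Perm.sign σ : ℤ) else 0 := by
  have hcol1 : ∀ j, col j ∈ S := fun j => hcol ▸ Finset.mem_image_of_mem _ (Finset.mem_univ j)
  have hcol2 : ∀ e ∈ S, ∃ j, col j = e := fun e he => by simpa [← hcol] using he
  have hra := rows_injective hai ha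
  have hrb := rows_injective hbi hb
  by_cases h : ∃ σ : Equiv.Perm (Fin k), S ∈ groveSet G bd a (b ∘ σ)
  · obtain ⟨σ, hσ⟩ := h
    rw [Finset.sum_eq_single σ, if_pos hσ]
    · have h1 := det_incMatrix_rows_of_mem_groveSet hai (hbi.comp σ.injective) ha
        (fun i => hb _) (fun i j => hab _ _) hσ hcol1
      rw [det_incMatrix_rows_comp_perm] at h1
      have h2 := det_incMatrix_mul_self hra hcol2 (exists_reachable_of_mem_groveSet hai
        (hbi.comp σ.injective) ha (fun i => hb _) (fun i j => hab _ _) hσ)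
      have h3 : ((Equiv.Perm.sign σ : ℤˣ) : ℤ) * (Equiv.Perm.sign σ : ℤ) = 1 := by
        rw [← Units.val_mul, Int.units_mul_self, Units.val_one]
      calc _ = (incMatrix G (rows bd a) col).det * ((((Equiv.Perm.sign σ : ℤˣ) : ℤ) *
            (Equiv.Perm.sign σ : ℤ)) * (incMatrix G (rows bd b) col).det) := by
              rw [h3, one_mul]
        _ = (Equiv.Perm.sign σ : ℤ) * (incMatrix G (rows bd a) col).det *
            ((Equiv.Perm.sign σ : ℤ) * (incMatrix G (rows bd b) col).det) := by ring
        _ = (-1) ^ k * (Equiv.Perm.sign σ : ℤ) * ((incMatrix G (rows bd a) col).det *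
            (incMatrix G (rows bd a) col).det) := by rw [h1]; ring
        _ = _ := by rw [h2, mul_one]
    · intro τ _ hne
      rw [if_neg fun hτ => hne (perm_eq_of_mem_groveSet hai hbi ha hb hab hτ hσ)]
    · exact fun h => (h (Finset.mem_univ _)).elim
  · rw [Finset.sum_eq_zero fun σ _ => if_neg fun hσ => h ⟨σ, hσ⟩]
    by_contra hne
    rw [mul_eq_zero, not_or] at hne
    have hSa := not_imp_comm.1 (det_incMatrix_eq_zero hra hcol1) hne.1
    have hSb := not_imp_comm.1 (det_incMatrix_eq_zero hrb hcol1) hne.2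
    refine h (exists_perm_mem_groveSet hai hbi ha hb hab hE
      (Ta := Finset.univ.filter fun x => x ∉ Set.range (rows bd a))
      (Tb := Finset.univ.filter fun x => x ∉ Set.range (rows bd b))
      (by simp) (by simp)
      (by simpa only [Finset.mem_filter, Finset.mem_univ, true_and] using hSa)
      (by simpa only [Finset.mem_filter, Finset.mem_univ, true_and] using hSb) ?_ ?_)
    · rw [hcard]; exact card_add_card_notMem_range hra
    · rw [hcard]; exact card_add_card_notMem_range hrb

/-- The Laplacian of `G` with edge set `F` and weights `wt`. -/
noncomputable def laplacian {R : Type*} [CommRing R] (G : Graph α β) (F : Finset β) (wt : β → R)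
    (u v : V(G)) : R :=
  ∑ e ∈ F, (incidence G e u : R) * wt e * (incidence G e v : R)

theorem exists_injective_image_univ_eq {m : Type*} [Fintype m] (S : Finset β)
    (hS : S.card = Fintype.card m) :
    ∃ f : m → β, Function.Injective f ∧ Finset.univ.image f = S := by
  let e : m ≃ S := Fintype.equivOfCardEq (by rw [Fintype.card_coe, hS])
  refine ⟨fun i => e i, Subtype.val_injective.comp e.injective, ?_⟩
  ext x
  simp only [Finset.mem_image, Finset.mem_univ, true_and]
  exact ⟨by rintro ⟨i, rfl⟩; exact (e i).2, fun hx => ⟨e.symm ⟨x, hx⟩, by simp⟩⟩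

end Minors

/-! ### Laplacian minors and the Schur complement -/

section Laplacian

open Classical

variable {α β R : Type*} [CommRing R] {G : Graph α β} {bd : Set V(G)} {k : ℕ}
  {a b : Fin k → V(G)} [Fintype V(G)]

/-- All minors of the Laplacian containing the interior vertices count signed groves. -/
theorem det_laplacian_rows (hE : E(G).Finite) (wt : β → R) (hai : Function.Injective a)
    (hbi : Function.Injective b)
    (ha : ∀ i, a i ∈ bd) (hb : ∀ i, b i ∈ bd) (hab : ∀ i j, a i ≠ b j) :
    (Matrix.of fun i j => laplacian G hE.toFinset wt (rows bd a i) (rows bd b j)).det =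
      (-1) ^ k * ∑ σ : Equiv.Perm (Fin k), ((Equiv.Perm.sign σ : ℤ) : R) *
        ∑ᶠ S ∈ groveSet G bd a (b ∘ σ), weight wt S := by
  -- The incidence minors are computed over `ℤ` and then cast to `R`.
  have hCB := Matrix.det_sum_mul_mul_eq_sum_powersetCard
    (Matrix.of fun i e => (incidence G e (rows bd a i) : R))
    (Matrix.of fun i e => (incidence G e (rows bd b i) : R)) wt hE.toFinset
    (fun S => ((∑ σ : Equiv.Perm (Fin k), if S ∈ groveSet G bd a (b ∘ σ) then
      (-1) ^ k * (Equiv.Perm.sign σ : ℤ) else 0 : ℤ) : R)) (by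
    intro S hS hcard
    obtain ⟨f, hf, himg⟩ := exists_injective_image_univ_eq S hcard
    refine ⟨f, hf, himg, ?_⟩
    rw [← det_mul_det_eq_sum_perm hai hbi ha hb hab (fun e he =>
      hE.mem_toFinset.1 (hS he)) hcard himg, Int.cast_mul, Int.cast_det, Int.cast_det]
    rfl)
  refine hCB.trans ?_
  have hsum : ∀ σ : Equiv.Perm (Fin k), ∑ᶠ S ∈ groveSet G bd a (b ∘ σ), weight wt S =
      ∑ S ∈ hE.toFinset.powersetCard (Fintype.card ({v // v ∉ bd} ⊕ Fin k)),
        if S ∈ groveSet G bd a (b ∘ σ) then weight wt S else 0 := by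
    intro σ
    rw [← Finset.sum_filter]
    refine finsum_mem_eq_sum_of_inter_support_eq _ ?_
    congr 1
    ext S
    simp only [Finset.coe_filter, Finset.mem_powersetCard, Set.mem_ofPred_eq]
    refine ⟨fun hS => ⟨⟨?_, ?_⟩, hS⟩, fun h => h.2⟩
    · intro e he
      exact hE.mem_toFinset.2 (hS.2.2.1.isSpanningForest.subset he)
    · exact card_of_mem_groveSet hai (hbi.comp σ.injective) ha (fun i => hb _)
        (fun i j => hab _ _) hS
  simp_rw [hsum, Finset.mul_sum]
  rw [Finset.sum_comm]
  refine Finset.sum_congr rfl fun S _ => ?_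
  rw [Int.cast_sum, Finset.mul_sum]
  refine Finset.sum_congr rfl fun σ _ => ?_
  split_ifs
  · simp only [weight]; push_cast; ring
  · simp

/-- The Laplacian on interior vertices. -/
noncomputable def interiorLaplacian (G : Graph α β) (bd : Set V(G)) (F : Finset β) (wt : β → R) :
    Matrix {v // v ∉ bd} {v // v ∉ bd} R :=
  Matrix.of fun x y => laplacian G F wt x y

/-- The case `k = 0`: the pairing partition is then the partition into singletons. -/
theorem det_interiorLaplacian (hE : E(G).Finite) (wt : β → R) :
    (interiorLaplacian G bd hE.toFinset wt).det = Z G bd wt := by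
  have h := det_laplacian_rows (G := G) (bd := bd) (k := 0) (a := Fin.elim0) (b := Fin.elim0)
    hE wt (fun i => i.elim0) (fun i => i.elim0) (fun i => i.elim0) (fun i => i.elim0)
    (fun i => i.elim0)
  have hgs : groveSet G bd (Fin.elim0 : Fin 0 → V(G)) Fin.elim0 = treeSet G bd := by
    ext S
    simp [groveSet, treeSet, pairingPartition, Function.injective_of_subsingleton]
  have hm : (Matrix.of fun i j => laplacian G hE.toFinset wt
      (rows bd (Fin.elim0 : Fin 0 → V(G)) i) (rows bd (Fin.elim0 : Fin 0 → V(G)) j)) =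
      Matrix.fromBlocks (interiorLaplacian G bd hE.toFinset wt) 0 0 1 := by
    ext i j
    rcases i with i | i
    · rcases j with j | j
      · rfl
      · exact j.elim0
    · exact i.elim0
  rw [hm, Matrix.det_fromBlocks_zero₂₁, Matrix.det_one, mul_one] at h
  rw [h]
  have : ∀ σ : Equiv.Perm (Fin 0), (Fin.elim0 : Fin 0 → V(G)) ∘ σ = Fin.elim0 :=
    fun σ => Subsingleton.elim _ _
  simp [this, hgs, Z]

/-- The Schur complement of the interior in the Laplacian. -/
noncomputable def schurComplement (G : Graph α β) [Fintype V(G)] (bd : Set V(G)) (F : Finset β)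
    (wt : β → R) (u v : V(G)) : R :=
  laplacian G F wt u v - ∑ y, (∑ x, laplacian G F wt u (x : {v // v ∉ bd}) *
    (interiorLaplacian G bd F wt)⁻¹ x y) * laplacian G F wt y v

theorem det_laplacian_rows_eq_mul_det_schurComplement (hE : E(G).Finite) (wt : β → R)
    (hZ : IsUnit (Z G bd wt)) (a b : Fin k → V(G)) :
    (Matrix.of fun i j => laplacian G hE.toFinset wt (rows bd a i) (rows bd b j)).det =
      Z G bd wt *
        (Matrix.of fun i j => schurComplement G bd hE.toFinset wt (a i) (b j)).det := by
  rw [← det_interiorLaplacian hE] at hZ ⊢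
  let _ := Matrix.invertibleOfIsUnitDet _ hZ
  have hm : (Matrix.of fun i j => laplacian G hE.toFinset wt (rows bd a i) (rows bd b j)) =
      Matrix.fromBlocks (interiorLaplacian G bd hE.toFinset wt)
        (Matrix.of fun x j => laplacian G hE.toFinset wt x (b j))
        (Matrix.of fun i y => laplacian G hE.toFinset wt (a i) y)
        (Matrix.of fun i j => laplacian G hE.toFinset wt (a i) (b j)) := by
    ext i j
    rcases i with i | i <;> rcases j with j | j <;> rfl
  rw [hm, Matrix.det_fromBlocks₁₁, Matrix.invOf_eq_nonsing_inv]
  rfl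

theorem signedGroveSum_eq_det_schurComplement (hE : E(G).Finite) (wt : β → R)
    (hZ : IsUnit (Z G bd wt)) (hai : Function.Injective a) (hbi : Function.Injective b)
    (ha : ∀ i, a i ∈ bd) (hb : ∀ i, b i ∈ bd) (hab : ∀ i j, a i ≠ b j) :
    signedGroveSum G bd wt a b = (-1) ^ k *
      (Matrix.of fun i j => schurComplement G bd hE.toFinset wt (a i) (b j)).det := by
  have h := det_laplacian_rows hE wt hai hbi ha hb hab
  rw [det_laplacian_rows_eq_mul_det_schurComplement hE wt hZ] at h
  have h1 : ((-1 : R) ^ k) * (-1) ^ k = 1 := by rw [← mul_pow]; simp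
  have h2 : Ring.inverse (Z G bd wt) * Z G bd wt = 1 := Ring.inverse_mul_cancel _ hZ
  calc signedGroveSum G bd wt a b
      = Ring.inverse (Z G bd wt) * ∑ σ : Equiv.Perm (Fin k), ((Equiv.Perm.sign σ : ℤ) : R) *
          ∑ᶠ S ∈ groveSet G bd a (b ∘ σ), weight wt S := by
        rw [signedGroveSum, Finset.mul_sum]
        refine Finset.sum_congr rfl fun σ _ => ?_
        rw [groveSum]; ring
    _ = Ring.inverse (Z G bd wt) * ((-1) ^ k * ((-1) ^ k *
          ∑ σ : Equiv.Perm (Fin k), ((Equiv.Perm.sign σ : ℤ) : R) *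
          ∑ᶠ S ∈ groveSet G bd a (b ∘ σ), weight wt S)) := by
        rw [← mul_assoc ((-1 : R) ^ k), h1, one_mul]
    _ = (Ring.inverse (Z G bd wt) * Z G bd wt) * ((-1) ^ k *
          (Matrix.of fun i j => schurComplement G bd hE.toFinset wt (a i) (b j)).det) := by
        rw [← h]; ring
    _ = _ := by rw [h2, one_mul]

end Laplacian

theorem signedGroveSum_eq_zero_of_not_injective {α β R : Type*} [CommRing R] {G : Graph α β}
    {bd : Set V(G)} {wt : β → R} {k : ℕ} {a b : Fin k → V(G)}
    (h : ¬ (Function.Injective a ∧ Function.Injective b)) : signedGroveSum G bd wt a b = 0 := by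
  refine Finset.sum_eq_zero fun σ _ => ?_
  have : groveSet G bd a (b ∘ σ) = ∅ := by
    refine Set.eq_empty_of_forall_notMem fun S hS => h ⟨hS.1, ?_⟩
    exact (Function.Injective.of_comp_iff' b σ.bijective).1 hS.2.1
  simp [groveSum, this]

end Grove

theorem mainTheorem3 {α β R : Type*} [CommRing R] (G : Graph α β)
    (hV : V(G).Finite) (hE : E(G).Finite)
    (bd : Set V(G)) (hbd : Grove.ComponentsMeetBoundary G bd)
    (wt : β → R) (hZ : IsUnit (Grove.Z G bd wt))
    (k : ℕ) (a b : Fin k → V(G)) (ha : ∀ i, a i ∈ bd) (hb : ∀ i, b i ∈ bd)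
    (hab : ∀ i j, a i ≠ b j) :
    Grove.signedGroveSum G bd wt a b =
      Matrix.det (Matrix.of fun i j : Fin k => Grove.signedGroveSum G bd wt ![a i] ![b j]) := by
  have := hV.fintype
  by_cases hai : Function.Injective a
  swap
  · rw [Grove.signedGroveSum_eq_zero_of_not_injective fun h => hai h.1]
    simp only [Function.Injective, not_forall] at hai
    obtain ⟨i, j, hij, hne⟩ := hai
    -- A repeated entry of `a` gives two equal rows.
    rw [Matrix.det_zero_of_row_eq hne]
    ext l
    simp [hij]
  by_cases hbi : Function.Injective b
  swap
  · rw [Grove.signedGroveSum_eq_zero_of_not_injective fun h => hbi h.2]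
    simp only [Function.Injective, not_forall] at hbi
    obtain ⟨i, j, hij, hne⟩ := hbi
    rw [Matrix.det_zero_of_column_eq hne]
    intro l
    simp [hij]
  rw [Grove.signedGroveSum_eq_det_schurComplement hE wt hZ hai hbi ha hb hab]
  have h : (Matrix.of fun i j : Fin k => Grove.signedGroveSum G bd wt ![a i] ![b j]) =
      -(Matrix.of fun i j => Grove.schurComplement G bd hE.toFinset wt (a i) (b j)) := by
    ext i j
    have := Grove.signedGroveSum_eq_det_schurComplement (a := ![a i]) (b := ![b j]) hE wt hZ
      (Function.injective_of_subsingleton _) (Function.injective_of_subsingleton _)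
      (by simpa using ha i) (by simpa using hb j) (by simpa using hab i j)
    -- For `k = 1` the sign is `-1` and the determinant is a single entry.
    simpa using this
  rw [h, Matrix.det_neg, Fintype.card_fin]
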